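/- Let $k$ be a field with duality $D=\operatorname{Hom}_k(-,k)$, let $d\ge 0$ be an integer, and let $(\mathcal T,\mathcal T^p,\mathcal S)$ be a $(-d)$-Calabi–Yau triple, that is: * $\mathcal T$ is a $k$-linear, Hom-finite, Krull–Schmidt triangulated category with shift functor $\Sigma$, and $\mathcal T^p\subseteq\mathcal T$ is a thick subcategory; * for $X\in\mathcal T^p$ and $Y\in\mathcal T$ there is a bifunctorial isomorphism $D\,\mathcal T(X,Y)\cong\mathcal T(Y,\Sigma^{-d}X)$; * $\mathcal S$ is a simple minded collection of objects of $\mathcal T$: for $X,Y\in\mathcal S$ one has $\mathcal T(X,\Sigma^{n}Y)=0$ for all $n<0$, $\dim_k\mathcal T(X,Y)$ is $1$ if $X\cong Y$ and $0$ otherwise, and the smallest thick subcategory of $\mathcal T$ containing $\mathcal S$ is $\mathcal T$; * the pairs $\big({}^{\perp}(\Sigma^{\ge 0}\mathcal S),\,{}^{\perp}(\Sigma^{<0}\mathcal S)\big)$ and $\big((\Sigma^{\ge 0}\mathcal S)^{\perp},\,(\Sigma^{<0}\mathcal S)^{\perp}\big)$ are co-$t$-structures on $\mathcal T$, and ${}^{\perp}(\Sigma^{\ge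 0}\mathcal S)\subseteq\mathcal T^p$ and $(\Sigma^{<0}\mathcal S)^{\perp}\subseteq\mathcal T^p$. Here $\Sigma^{\ge 0}\mathcal S$ (resp. $\Sigma^{<0}\mathcal S$) consists of the objects $\Sigma^nX$ with $X\in\mathcal S$ and $n\ge 0$ (resp. $n<0$); for a class $\mathcal C$ of objects, ${}^{\perp}\mathcal C$ (resp. $\mathcal C^{\perp}$) is the full subcategory of the objects $X$ with $\mathcal T(X,C)=0$ (resp. $\mathcal T(C,X)=0$) for all $C\in\mathcal C$; and a pair $(\mathcal A,\mathcal B)$ of full subcategories closed under direct summands is a co-$t$-structure if $\mathcal T(\mathcal A,\mathcal B)=0$, every $X\in\mathcal T$ lies in a distinguished triangle $A\to X\to B\to\Sigma A$ with $A\in\mathcal A$ and $B\in\mathcal B$, and $\Sigma^{-1}\mathcal A\subseteq\mathcal A$. Then the Verdier quotient $\mathcal T/\mathcal T^p$ is Hom-finite and $(-d-1)$-Calabi–Yau: all its Hom-spaces are finite-dimensional over $k$, and there is an isomorphism $$D\,(\mathcal T/\mathcal T^p)(X,Y)\;\cong\;(\mathcal T/\mathcal T^p)(Y,\Sigma^{-d-1}X),$$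 bifunctorial in $X,Y\in\mathcal T/\mathcal T^p$; equivalently, $(\mathcal T/\mathcal T^p)(Y,X)\cong D\,(\mathcal T/\mathcal T^p)(\Sigma^{d+1}X,Y)$ bifunctorially. -/

import Mathlib

open CategoryTheory CategoryTheory.Limits CategoryTheory.Pretriangulated

universe w v u

namespace NegCY

section Thick

variable {C : Type u} [Category.{v} C] [Preadditive C] [HasZeroObject C] [HasShift C ℤ]
  [∀ n : ℤ, (shiftFunctor C n).Additive] [Pretriangulated C]

/-- A thick subcategory of a triangulated category: a full triangulated subcategory (it contains
zero, and is closed under all shifts and under extensions) which is closed under direct summands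
(and hence under isomorphisms). -/
class IsThick (P : ObjectProperty C) : Prop extends P.IsTriangulated, P.IsStableUnderRetracts

/-- `thick(P) = C`: the only thick subcategory containing `P` is the whole category. -/
def ThickGenerates (P : ObjectProperty C) : Prop :=
  ∀ Q : ObjectProperty C, IsThick Q → P ≤ Q → ∀ X : C, Q X

/-- The objects `Σⁿ X` (up to isomorphism) with `X` in `P` and `n ∈ I`. For instance
`shiftsIn P (Set.Ici 0)` is `Σ^{≥ 0} P` and `shiftsIn P (Set.Iio 0)` is `Σ^{< 0} P`. -/
def shiftsIn (P : ObjectProperty C) (I : Set ℤ) : ObjectProperty C :=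
  fun Y => ∃ (X : C) (n : ℤ), P X ∧ n ∈ I ∧ Nonempty (Y ≅ X⟦n⟧)

/-- `C = A ⊥ B` is a co-t-structure: `A` and `B` are closed under direct summands, there are no
nonzero morphisms from `A` to `B`, every object `X` sits in a distinguished triangle
`a ⟶ X ⟶ b ⟶ Σ a` with `a` in `A` and `b` in `B`, and `Σ⁻¹ A ⊆ A`. -/
structure IsCoTStructure (A B : ObjectProperty C) : Prop where
  retracts_left : A.IsStableUnderRetracts
  retracts_right : B.IsStableUnderRetracts
  hom_eq_zero : ∀ ⦃X Y : C⦄ (f : X ⟶ Y), A X → B Y → f = 0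
  exists_triangle : ∀ X : C, ObjectProperty.extensionProduct A B X
  shift_le : ∀ X : C, A X → A (X⟦(-1 : ℤ)⟧)

end Thick

section Linear

variable (k : Type w) [Field k] (C : Type u) [Category.{v} C] [Preadditive C] [Linear k C]

/-- All `Hom`-spaces are finite dimensional over `k`. -/
def HomFinite : Prop := ∀ X Y : C, Module.Finite k (X ⟶ Y)

/-- Every object is a finite direct sum of objects with local endomorphism rings. -/
def IsKrullSchmidt (C : Type u) [Category.{v} C] [Preadditive C] [HasFiniteBiproducts C] : Prop :=
  ∀ X : C, ∃ (n : ℕ) (Y : Fin n → C), (∀ i, IsLocalRing (End (Y i))) ∧ Nonempty (X ≅ ⨁ Y)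

variable {C}

/-- Bifunctorial `k`-linear isomorphisms `D Hom(X, Y) ≅ Hom(Y, F X)` for all `X` in `P` and all
`Y` in `C`, where `D` is the `k`-linear dual. The second conjunct is naturality in both variables,
both sides being covariant in `X` (in the full subcategory `P`) and contravariant in `Y`. -/
def HasSerreDuality (F : C ⥤ C) (P : ObjectProperty C) : Prop :=
  ∃ e : ∀ X Y : C, P X → (Module.Dual k (X ⟶ Y) ≃ₗ[k] (Y ⟶ F.obj X)),
    ∀ ⦃X X' Y Y' : C⦄ (hX : P X) (hX' : P X') (f : X ⟶ X') (g : Y' ⟶ Y)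
      (φ : Module.Dual k (X ⟶ Y)),
      e X' Y' hX' (φ ∘ₗ (Linear.leftComp k Y f ∘ₗ Linear.rightComp k X' g)) =
        g ≫ e X Y hX φ ≫ F.map f

variable (C) in
/-- `C` is `n`-Calabi-Yau: there are bifunctorial isomorphisms `D Hom(X, Y) ≅ Hom(Y, Σⁿ X)`. -/
def IsCalabiYau [HasShift C ℤ] (n : ℤ) : Prop :=
  HasSerreDuality k (shiftFunctor C n) ⊤

end Linear

section Triple

variable (k : Type w) [Field k] {C : Type u} [Category.{v} C] [Preadditive C] [Linear k C]
  [HasZeroObject C] [HasShift C ℤ] [∀ n : ℤ, (shiftFunctor C n).Additive] [Pretriangulated C]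

/-- A simple minded collection `S` in `C` (a class of objects, considered up to isomorphism):
there are no nonzero morphisms `X ⟶ Σⁿ Y` for `X, Y` in `S` and `n < 0`; the space `Hom(X, Y)` is
one-dimensional if `X ≅ Y` and zero otherwise, for `X, Y` in `S`; and `thick(S) = C`. -/
structure IsSimpleMindedCollection (S : ObjectProperty C) : Prop where
  hom_shift_eq_zero : ∀ ⦃X Y : C⦄, S X → S Y → ∀ n : ℤ, n < 0 → ∀ f : X ⟶ Y⟦n⟧, f = 0
  finrank_eq_one : ∀ ⦃X Y : C⦄, S X → S Y → Nonempty (X ≅ Y) → Module.finrank k (X ⟶ Y) = 1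
  hom_eq_zero : ∀ ⦃X Y : C⦄, S X → S Y → ¬ Nonempty (X ≅ Y) → ∀ f : X ⟶ Y, f = 0
  thick : ThickGenerates S

/-- `(C, P, S)` is a `(-d)`-Calabi-Yau triple, where `C` is a `k`-linear triangulated category
and `P` is a thick subcategory of `C`. That is, `(C, P, F, S)` is a simple minded collection
quadruple for the triangle equivalence `F = Σ^{-d}` (which automatically preserves `P`). -/
structure IsNegativeCalabiYauTriple (d : ℕ) (P : ObjectProperty C) [IsThick P]
    (S : ObjectProperty C) : Prop where
  homFinite : HomFinite k C
  krullSchmidt : IsKrullSchmidt C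
  serre : HasSerreDuality k (shiftFunctor C (-(d : ℤ))) P
  smc : IsSimpleMindedCollection k S
  coT_left : IsCoTStructure (shiftsIn S (Set.Ici 0)).leftOrthogonal
    (shiftsIn S (Set.Iio 0)).leftOrthogonal
  coT_right : IsCoTStructure (shiftsIn S (Set.Ici 0)).rightOrthogonal
    (shiftsIn S (Set.Iio 0)).rightOrthogonal
  left_le : (shiftsIn S (Set.Ici 0)).leftOrthogonal ≤ P
  right_le : (shiftsIn S (Set.Iio 0)).rightOrthogonal ≤ P

end Triple

section Quotient

variable {C : Type u} [Category.{v} C] [Preadditive C]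
  [HasZeroObject C] [HasShift C ℤ] [∀ n : ℤ, (shiftFunctor C n).Additive] [Pretriangulated C]

/-- The Verdier quotient `C / P`: the localization of `C` at the morphisms whose cone lies in `P`.
It carries Mathlib's preadditive, `k`-linear, shift and triangulated structures, for which the
quotient functor `P.trW.Q : C ⥤ C / P` is `k`-linear and triangulated. -/
abbrev VerdierQuotient (P : ObjectProperty C) := P.trW.Localization

end Quotient

end NegCY

/-! Serre duality on `Tp` amounts to cyclic, nondegenerate trace forms `X ⟶ X⟦m⟧` to `k`, with `m =
-d`. They induce traces on the quotient in degree `n = m - 1`: write `X ⟶ X⟦n⟧` as a fraction `X ⟵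
X' ⟶ X⟦n⟧` whose denominator has cone `N` in `Tp`, and take the trace of `N ⟶ X'⟦1⟧ ⟶ X⟦m⟧ ⟶ N⟦m⟧`.
The connecting map of the cone accounts for the drop in degree. Independence of the fraction and
cyclicity both come from `coneTrace_comp`.

Nondegeneracy (`exists_factors_of_coneTrace_eq_zero`) needs every `X` to be approximated from both
sides by objects of `Tp`, relative to a test object. The two co-t-structures provide this, since
`thick(S) = T` makes every object bounded with respect to them. A morphism orthogonal to everything
then factors through `Tp` after a shift, so it dies in the quotient.

For Hom-finiteness, `X` is isomorphic in the quotient to a truncation `a` so deep that `Hom(a, Y)`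
in `T` surjects onto the quotient Hom-space. -/

namespace NegCY

/-! ### Serre duality as trace forms -/

section Trace

variable (k : Type w) [Field k] {C : Type u} [Category.{v} C] [Preadditive C] [Linear k C]

/-- A family of trace forms `Hom(X, F X) → k` for `X` in `P`, which is cyclic and such that
`(h, u) ↦ trace (h ≫ u)` identifies `Hom(Y, F X)` with the dual of `Hom(X, Y)`. -/
structure SerreTrace (F : C ⥤ C) (P : ObjectProperty C) where
  trace (X : C) (hX : P X) : (X ⟶ F.obj X) →ₗ[k] k
  cyclic {X Y : C} (hX : P X) (hY : P Y) (f : X ⟶ Y) (u : Y ⟶ F.obj X) :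
    trace X hX (f ≫ u) = trace Y hY (u ≫ F.map f)
  exists_eq {X : C} (hX : P X) (Y : C) (l : (X ⟶ Y) →ₗ[k] k) :
    ∃ u : Y ⟶ F.obj X, ∀ h : X ⟶ Y, l h = trace X hX (h ≫ u)
  eq_zero {X : C} (hX : P X) {Y : C} (u : Y ⟶ F.obj X)
    (hu : ∀ h : X ⟶ Y, trace X hX (h ≫ u) = 0) : u = 0

variable {k} {F : C ⥤ C} {P : ObjectProperty C}

/-- The trace of `u` is the functional corresponding to `u`, evaluated at the identity; naturality
recovers the whole duality from it. -/
lemma HasSerreDuality.nonempty_serreTrace (H : HasSerreDuality k F P) :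
    Nonempty (SerreTrace k F P) := by
  obtain ⟨e, he⟩ := H
  have he' : ∀ ⦃X X' Y Y' : C⦄ (hX : P X) (hX' : P X') (f : X ⟶ X') (g : Y' ⟶ Y)
      (u : Y ⟶ F.obj X) (h : X' ⟶ Y'), (e X' Y' hX').symm (g ≫ u ≫ F.map f) h =
        (e X Y hX).symm u (f ≫ h ≫ g) := by
    intro X X' Y Y' hX hX' f g u h
    have := he hX hX' f g ((e X Y hX).symm u)
    rw [LinearEquiv.apply_symm_apply] at this
    rw [← this, LinearEquiv.symm_apply_apply]
    simp
  have key : ∀ {X Y : C} (hX : P X) (h : X ⟶ Y) (u : Y ⟶ F.obj X),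
      (e X X hX).symm (h ≫ u) (𝟙 X) = (e X Y hX).symm u h := by
    intro X Y hX h u
    simpa using he' hX hX (𝟙 X) h u (𝟙 X)
  refine ⟨{ trace := fun X hX => (LinearMap.applyₗ (𝟙 X)).comp (e X X hX).symm.toLinearMap
            cyclic := ?_, exists_eq := ?_, eq_zero := ?_ }⟩
  · intro X Y hX hY f u
    have := he' hX hY f (𝟙 _) u (𝟙 Y)
    simp only [Category.id_comp, Category.comp_id] at this
    simp [this, key]
  · intro X hX Y l
    exact ⟨e X Y hX l, fun h => by simp [key]⟩
  · intro X hX Y u hu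
    apply (e X Y hX).symm.injective
    ext h
    simpa [key] using hu h

lemma SerreTrace.hom_eq_zero (τ : SerreTrace k F P) {X Y : C} (hX : P X)
    (H : ∀ u : Y ⟶ F.obj X, u = 0) (f : X ⟶ Y) : f = 0 := by
  rw [← Module.forall_dual_apply_eq_zero_iff k]
  intro l
  obtain ⟨u, hu⟩ := τ.exists_eq hX Y l
  rw [hu, H u]
  simp

end Trace

/-! ### The induced trace on the Verdier quotient -/

section QuotientTrace

variable {k : Type w} [Field k] {C : Type u} [Category.{v} C] [Preadditive C] [Linear k C]
  [HasZeroObject C] [HasShift C ℤ] [∀ n : ℤ, (shiftFunctor C n).Additive]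
  [∀ n : ℤ, (shiftFunctor C n).Linear k] [Pretriangulated C]
  {P : ObjectProperty C}

omit [Linear k C] [∀ n : ℤ, (shiftFunctor C n).Linear k] in
lemma exists_map_comp_eq_map [IsTriangulated C] [P.IsTriangulated] {X Y : C}
    (φ : P.trW.Q.obj X ⟶ P.trW.Q.obj Y) :
    ∃ (X' N : C) (s : X' ⟶ X) (s' : X ⟶ N) (δ : N ⟶ X'⟦(1 : ℤ)⟧) (f : X' ⟶ Y),
      P N ∧ Triangle.mk s s' δ ∈ distTriang C ∧ P.trW.Q.map s ≫ φ = P.trW.Q.map f := by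
  obtain ⟨z, rfl⟩ := Localization.exists_rightFraction P.trW.Q P.trW φ
  obtain ⟨N, s', δ, hs, hN⟩ := z.hs
  exact ⟨_, N, z.s, s', δ, z.f, hN, hs, z.map_s_comp_map _ _⟩

namespace SerreTrace

variable {n m : ℤ} (τ : SerreTrace k (shiftFunctor C m) P) (hnm : n + 1 = m)

/-- The trace of the endomorphism up to shift `N ⟶ X'⟦1⟧ ⟶ X⟦m⟧ ⟶ N⟦m⟧`, where `N` is the cone
of a morphism `X' ⟶ X`. -/
noncomputable def coneTrace {X X' N : C} (hN : P N) (s' : X ⟶ N) (δ : N ⟶ X'⟦(1 : ℤ)⟧)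
    (f : X' ⟶ X⟦n⟧) : k :=
  τ.trace N hN (δ ≫ f⟦(1 : ℤ)⟧' ≫ (shiftFunctorAdd' C n 1 m hnm).inv.app X ≫ s'⟦m⟧')

omit [HasZeroObject C] [∀ n : ℤ, (shiftFunctor C n).Linear k] [Pretriangulated C] in
lemma coneTrace_add {X X' N : C} (hN : P N) (s' : X ⟶ N) (δ : N ⟶ X'⟦(1 : ℤ)⟧)
    (f g : X' ⟶ X⟦n⟧) : τ.coneTrace hnm hN s' δ (f + g) =
      τ.coneTrace hnm hN s' δ f + τ.coneTrace hnm hN s' δ g := by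
  simp [coneTrace, Functor.map_add]

omit [HasZeroObject C] [∀ n : ℤ, (shiftFunctor C n).Additive] [Pretriangulated C] in
lemma coneTrace_smul {X X' N : C} (hN : P N) (s' : X ⟶ N) (δ : N ⟶ X'⟦(1 : ℤ)⟧)
    (c : k) (f : X' ⟶ X⟦n⟧) : τ.coneTrace hnm hN s' δ (c • f) =
      c • τ.coneTrace hnm hN s' δ f := by
  simp [coneTrace, Functor.map_smul]

omit [∀ n : ℤ, (shiftFunctor C n).Linear k] in
-- The square extends to a morphism of triangles; its component `N ⟶ M` is moved around the trace by
-- cyclicity on `P`.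
lemma coneTrace_comp {X X' N Y Y' M : C} (hN : P N) (hM : P M)
    {s : X' ⟶ X} {s' : X ⟶ N} {δ : N ⟶ X'⟦(1 : ℤ)⟧} (hs : Triangle.mk s s' δ ∈ distTriang C)
    {t : Y' ⟶ Y} {t' : Y ⟶ M} {ε : M ⟶ Y'⟦(1 : ℤ)⟧} (ht : Triangle.mk t t' ε ∈ distTriang C)
    (a : X' ⟶ Y') (b : X ⟶ Y) (fac : s ≫ b = a ≫ t) (g : Y' ⟶ X⟦n⟧) :
    τ.coneTrace hnm hN s' δ (a ≫ g) = τ.coneTrace hnm hM t' ε (g ≫ b⟦n⟧') := by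
  obtain ⟨r, hr, hr'⟩ := complete_distinguished_triangle_morphism _ _ hs ht a b fac
  dsimp only [Triangle.mk] at r hr hr'
  have nat := (shiftFunctorAdd' C n 1 m hnm).inv.naturality b
  simp only [coneTrace, Functor.map_comp, Category.assoc]
  rw [reassoc_of% hr', τ.cyclic hN hM, reassoc_of% nat]
  simp only [Category.assoc, ← Functor.map_comp, hr]

variable [IsTriangulated C] [P.IsTriangulated]

omit [∀ n : ℤ, (shiftFunctor C n).Linear k] in
lemma coneTrace_eq {X X' N X'' N' : C} (hN : P N) (hN' : P N')
    {s : X' ⟶ X} {s' : X ⟶ N} {δ : N ⟶ X'⟦(1 : ℤ)⟧} (hs : Triangle.mk s s' δ ∈ distTriang C)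
    {t : X'' ⟶ X} {t' : X ⟶ N'} {ε : N' ⟶ X''⟦(1 : ℤ)⟧} (ht : Triangle.mk t t' ε ∈ distTriang C)
    (f : X' ⟶ X⟦n⟧) (g : X'' ⟶ X⟦n⟧) (φ : P.trW.Q.obj X ⟶ P.trW.Q.obj (X⟦n⟧))
    (hf : P.trW.Q.map s ≫ φ = P.trW.Q.map f) (hg : P.trW.Q.map t ≫ φ = P.trW.Q.map g) :
    τ.coneTrace hnm hN s' δ f = τ.coneTrace hnm hN' t' ε g := by
  have hsW : P.trW s := ⟨_, _, _, hs, hN⟩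
  obtain ⟨z, hz⟩ := (MorphismProperty.LeftFraction.mk t s hsW).exists_rightFraction
  dsimp at hz
  obtain ⟨Z, w, hw, fac⟩ := (MorphismProperty.map_eq_iff_precomp P.trW.Q P.trW
    (z.f ≫ f) (z.s ≫ g)).1 (by
      rw [Functor.map_comp, Functor.map_comp, ← hf, ← hg, ← Functor.map_comp_assoc,
        ← Functor.map_comp_assoc, hz])
  have hW : P.trW (w ≫ z.s ≫ t) :=
    P.trW.comp_mem _ _ hw (P.trW.comp_mem _ _ z.hs ⟨_, _, _, ht, hN'⟩)
  obtain ⟨M, r', ρ, hr, hM⟩ := hW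
  have h₁ := τ.coneTrace_comp hnm hM hN hr hs (w ≫ z.f) (𝟙 X) (by simp [hz]) f
  have h₂ := τ.coneTrace_comp hnm hM hN' hr ht (w ≫ z.s) (𝟙 X) (by simp) g
  simp only [CategoryTheory.Functor.map_id, Category.comp_id, Category.assoc] at h₁ h₂
  rw [← h₁, ← h₂, fac]

lemma exists_quotientTrace (X : C) :
    ∃ t : (P.trW.Q.obj X ⟶ P.trW.Q.obj (X⟦n⟧)) →ₗ[k] k,
      ∀ {X' N : C} (hN : P N) {s : X' ⟶ X} {s' : X ⟶ N} {δ : N ⟶ X'⟦(1 : ℤ)⟧}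
        (_ : Triangle.mk s s' δ ∈ distTriang C) (f : X' ⟶ X⟦n⟧)
        (φ : P.trW.Q.obj X ⟶ P.trW.Q.obj (X⟦n⟧)) (_ : P.trW.Q.map s ≫ φ = P.trW.Q.map f),
        t φ = τ.coneTrace hnm hN s' δ f := by
  have key (φ : P.trW.Q.obj X ⟶ P.trW.Q.obj (X⟦n⟧)) : ∃ c : k, ∀ {X' N : C} (hN : P N)
      {s : X' ⟶ X} {s' : X ⟶ N} {δ : N ⟶ X'⟦(1 : ℤ)⟧}
      (_ : Triangle.mk s s' δ ∈ distTriang C) (f : X' ⟶ X⟦n⟧)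
      (_ : P.trW.Q.map s ≫ φ = P.trW.Q.map f), c = τ.coneTrace hnm hN s' δ f := by
    obtain ⟨X', N, s, s', δ, f, hN, hs, hf⟩ := exists_map_comp_eq_map φ
    exact ⟨τ.coneTrace hnm hN s' δ f, fun hN' _ _ _ ht g hg =>
      τ.coneTrace_eq hnm hN hN' hs ht f g φ hf hg⟩
  choose t ht using key
  refine ⟨{ toFun := t, map_add' := fun φ ψ => ?_, map_smul' := fun c φ => ?_ },
    @fun _ _ hN _ _ _ hs f φ hf => ht φ hN hs f hf⟩
  -- Additivity: pass to the common denominator `z.s ≫ s₂ = z.f ≫ s₁`.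
  · obtain ⟨X₁, N₁, s₁, s₁', δ₁, f₁, hN₁, hs₁, hf₁⟩ := exists_map_comp_eq_map φ
    obtain ⟨X₂, N₂, s₂, s₂', δ₂, f₂, hN₂, hs₂, hf₂⟩ := exists_map_comp_eq_map ψ
    obtain ⟨z, hz⟩ := (MorphismProperty.LeftFraction.mk (W := P.trW) s₂ s₁
      (⟨_, _, _, hs₁, hN₁⟩ : P.trW s₁)).exists_rightFraction
    dsimp at hz
    obtain ⟨N, s', δ, hs, hN⟩ := P.trW.comp_mem _ _ z.hs (⟨_, _, _, hs₂, hN₂⟩ : P.trW s₂)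
    have h₁ : P.trW.Q.map (z.s ≫ s₂) ≫ φ = P.trW.Q.map (z.f ≫ f₁) := by
      rw [hz, Functor.map_comp, Functor.map_comp, Category.assoc, hf₁]
    have h₂ : P.trW.Q.map (z.s ≫ s₂) ≫ ψ = P.trW.Q.map (z.s ≫ f₂) := by
      rw [Functor.map_comp, Functor.map_comp, Category.assoc, hf₂]
    rw [ht φ hN hs _ h₁, ht ψ hN hs _ h₂, ← coneTrace_add]
    exact ht _ hN hs _ (by rw [Preadditive.comp_add, h₁, h₂, Functor.map_add])
  · obtain ⟨X', N, s, s', δ, f, hN, hs, hf⟩ := exists_map_comp_eq_map φ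
    rw [ht φ hN hs f hf, RingHom.id_apply, ← coneTrace_smul]
    exact ht _ hN hs _ (by rw [Linear.comp_smul, hf, Functor.map_smul])

/-- The trace form on the Verdier quotient induced by a trace form on the thick subcategory. -/
noncomputable def quotientTrace (X : C) : (P.trW.Q.obj X ⟶ P.trW.Q.obj (X⟦n⟧)) →ₗ[k] k :=
  (τ.exists_quotientTrace hnm X).choose

lemma quotientTrace_eq {X X' N : C} (hN : P N) {s : X' ⟶ X} {s' : X ⟶ N} {δ : N ⟶ X'⟦(1 : ℤ)⟧}
    (hs : Triangle.mk s s' δ ∈ distTriang C) (f : X' ⟶ X⟦n⟧)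
    (φ : P.trW.Q.obj X ⟶ P.trW.Q.obj (X⟦n⟧)) (hf : P.trW.Q.map s ≫ φ = P.trW.Q.map f) :
    τ.quotientTrace hnm X φ = τ.coneTrace hnm hN s' δ f :=
  (τ.exists_quotientTrace hnm X).choose_spec hN hs f φ hf

lemma quotientTrace_map_comp {X Y : C} (f : X ⟶ Y)
    (ψ : P.trW.Q.obj Y ⟶ P.trW.Q.obj (X⟦n⟧)) :
    τ.quotientTrace hnm X (P.trW.Q.map f ≫ ψ) =
      τ.quotientTrace hnm Y (ψ ≫ P.trW.Q.map (f⟦n⟧')) := by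
  obtain ⟨Y', N, t, t', ε, g, hN, ht, hg⟩ := exists_map_comp_eq_map ψ
  obtain ⟨z, hz⟩ := (MorphismProperty.LeftFraction.mk (W := P.trW) f t
    (⟨_, _, _, ht, hN⟩ : P.trW t)).exists_rightFraction
  dsimp at hz
  obtain ⟨M, s', δ, hs, hM⟩ := z.hs
  rw [τ.quotientTrace_eq hnm hM hs (z.f ≫ g) _ (by
      rw [← Functor.map_comp_assoc, hz, Functor.map_comp, Functor.map_comp, Category.assoc, hg]),
    τ.quotientTrace_eq hnm hN ht (g ≫ f⟦n⟧') _ (by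
      rw [← Category.assoc, hg, Functor.map_comp])]
  exact τ.coneTrace_comp hnm hM hN hs ht z.f f hz g

end SerreTrace

end QuotientTrace

/-! ### Nondegeneracy and cyclicity on the quotient -/

section Nondegenerate

variable {k : Type w} [Field k] {C : Type u} [Category.{v} C] [Preadditive C] [Linear k C]
  [HasZeroObject C] [HasShift C ℤ] [∀ n : ℤ, (shiftFunctor C n).Additive]
  [∀ n : ℤ, (shiftFunctor C n).Linear k] [Pretriangulated C] [IsTriangulated C]
  {P : ObjectProperty C} [P.IsTriangulated]

omit [Linear k C] [∀ n : ℤ, (shiftFunctor C n).Linear k] in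
lemma map_eq_zero_of_factors {X Y N : C} (hN : P N) (u : X ⟶ N) (v : N ⟶ Y) :
    P.trW.Q.map (u ≫ v) = 0 := by
  obtain ⟨X', s, δ, hs⟩ := distinguished_cocone_triangle₁ u
  have hsu : s ≫ u = 0 := comp_distTriang_mor_zero₁₂ _ hs
  rw [← P.trW.Q.map_zero, MorphismProperty.map_eq_iff_precomp P.trW.Q P.trW]
  exact ⟨X', s, ⟨_, _, _, hs, hN⟩, by simp [reassoc_of% hsu]⟩

omit [Linear k C] [∀ n : ℤ, (shiftFunctor C n).Linear k] in
lemma map_eq_zero_of_map_shift_eq_zero {X Y : C} (f : X ⟶ Y) (a : ℤ)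
    (hf : P.trW.Q.map (f⟦a⟧') = 0) : P.trW.Q.map f = 0 := by
  apply (shiftFunctor P.trW.Localization a).map_injective
  rw [Functor.map_zero, ← cancel_epi ((P.trW.Q.commShiftIso a).hom.app X),
    ← Functor.commShiftIso_hom_naturality, hf, zero_comp, comp_zero]

lemma exists_dual_comp_eq {V W : Type*} [AddCommGroup V] [Module k V] [AddCommGroup W] [Module k W]
    (r : V →ₗ[k] W) (μ : V →ₗ[k] k) (h : ∀ x, r x = 0 → μ x = 0) :
    ∃ l : W →ₗ[k] k, ∀ x, l (r x) = μ x := by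
  have : μ ∈ LinearMap.range r.dualMap := by
    rw [LinearMap.range_dualMap_eq_dualAnnihilator_ker, Submodule.mem_dualAnnihilator]
    exact fun x hx => h x hx
  obtain ⟨l, rfl⟩ := this
  exact ⟨l, fun x => rfl⟩

namespace SerreTrace

variable {n m : ℤ} (τ : SerreTrace k (shiftFunctor C m) P) (hnm : n + 1 = m)

include hnm in
omit [∀ n : ℤ, (shiftFunctor C n).Linear k] [IsTriangulated C] [P.IsTriangulated] in
-- The functional `h ↦ trace (h ≫ γ ≫ i⟦m⟧')` on `Hom(N, Y⟦1⟧)` descends along precomposition with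
-- `p ≫ i`, hence is represented by some `u : Y⟦1⟧ ⟶ M⟦m⟧`. Cyclicity and the injectivity condition
-- on `i` then force `γ = u ≫ p⟦m⟧'`.
lemma exists_factors_of_coneTrace_eq_zero {X Y M : C}
    (hM : P M) (p : M ⟶ X) (hp : ∀ f : X ⟶ Y⟦(1 : ℤ)⟧, p ≫ f = 0 → f = 0)
    {X' N : C} (hN : P N) {s : X' ⟶ X} {i : X ⟶ N} {δ : N ⟶ X'⟦(1 : ℤ)⟧}
    (hs : Triangle.mk s i δ ∈ distTriang C)
    (hi : ∀ u : Y⟦(1 : ℤ)⟧ ⟶ X⟦m⟧, u ≫ i⟦m⟧' = 0 → u = 0) (g : Y ⟶ X⟦n⟧)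
    (hg : ∀ f : X' ⟶ Y, τ.coneTrace hnm hN i δ (f ≫ g) = 0) :
    ∃ (u : Y⟦(1 : ℤ)⟧ ⟶ M⟦m⟧) (v : M⟦m⟧ ⟶ X⟦n⟧⟦(1 : ℤ)⟧), g⟦(1 : ℤ)⟧' = u ≫ v := by
  let γ : Y⟦(1 : ℤ)⟧ ⟶ X⟦m⟧ := g⟦(1 : ℤ)⟧' ≫ (shiftFunctorAdd' C n 1 m hnm).inv.app X
  obtain ⟨l, hl⟩ := exists_dual_comp_eq (Linear.leftComp k (Y⟦(1 : ℤ)⟧) (p ≫ i))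
    (τ.trace N hN ∘ₗ Linear.rightComp k N (γ ≫ i⟦m⟧')) (fun h hh => by
      rw [Linear.leftComp_apply, Category.assoc] at hh
      -- `hp` gives `i ≫ h = 0`, so `h` factors through `δ` and the hypothesis on cone traces
      -- applies.
      obtain ⟨w, rfl⟩ := Triangle.yoneda_exact₃ _ hs h (hp _ hh)
      obtain ⟨f, rfl⟩ : ∃ f : X' ⟶ Y, f⟦(1 : ℤ)⟧' = w := (shiftFunctor C (1 : ℤ)).map_surjective w
      change τ.trace N hN ((δ ≫ f⟦(1 : ℤ)⟧') ≫ γ ≫ i⟦m⟧') = 0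
      rw [← hg f]
      simp only [coneTrace, γ, Functor.map_comp, Category.assoc])
  obtain ⟨u, hu⟩ := τ.exists_eq hM _ l
  have key : γ = u ≫ p⟦m⟧' := by
    rw [← sub_eq_zero]
    apply hi
    apply τ.eq_zero hN
    intro h
    have h₁ := hl h
    rw [hu] at h₁
    rw [Linear.leftComp_apply, Category.assoc, τ.cyclic hM hN (p ≫ i)] at h₁
    simpa [sub_eq_zero] using h₁.symm
  refine ⟨u, p⟦m⟧' ≫ (shiftFunctorAdd' C n 1 m hnm).hom.app X, ?_⟩
  rw [← Category.assoc, ← key]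
  simp [γ]

lemma eq_zero_of_quotientTrace_eq_zero {X Y : C}
    (hcov : ∀ Y : C, ∃ (M : C) (p : M ⟶ X), P M ∧ ∀ f : X ⟶ Y, p ≫ f = 0 → f = 0)
    (henv : ∀ Y : C, ∃ (N : C) (i : X ⟶ N), P N ∧ ∀ u : Y ⟶ X⟦m⟧, u ≫ i⟦m⟧' = 0 → u = 0)
    (ψ : P.trW.Q.obj Y ⟶ P.trW.Q.obj (X⟦n⟧))
    (hψ : ∀ φ : P.trW.Q.obj X ⟶ P.trW.Q.obj Y, τ.quotientTrace hnm X (φ ≫ ψ) = 0) : ψ = 0 := by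
  obtain ⟨Y', N', t, t', ε, g, hN', ht, hg⟩ := exists_map_comp_eq_map ψ
  have : IsIso (P.trW.Q.map t) := Localization.inverts P.trW.Q P.trW t ⟨_, _, _, ht, hN'⟩
  rw [← cancel_epi (P.trW.Q.map t), hg, comp_zero]
  obtain ⟨M, p, hM, hp⟩ := hcov (Y'⟦(1 : ℤ)⟧)
  obtain ⟨N, i, hN, hi⟩ := henv (Y'⟦(1 : ℤ)⟧)
  obtain ⟨X', s, δ, hs⟩ := distinguished_cocone_triangle₁ i
  have : IsIso (P.trW.Q.map s) := Localization.inverts P.trW.Q P.trW s ⟨_, _, _, hs, hN⟩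
  obtain ⟨u, v, huv⟩ := τ.exists_factors_of_coneTrace_eq_zero hnm hM p hp hN hs hi g (fun f => by
    rw [← hψ (inv (P.trW.Q.map s) ≫ P.trW.Q.map f ≫ P.trW.Q.map t)]
    exact (τ.quotientTrace_eq hnm hN hs _ _ (by simp [hg])).symm)
  apply map_eq_zero_of_map_shift_eq_zero g 1
  rw [huv]
  exact map_eq_zero_of_factors (P := P) (P.le_shift m _ hM : P (M⟦m⟧)) u v

lemma quotientTrace_map_comp_commShiftIso {X Y : C} (f : X ⟶ Y)
    (u : P.trW.Q.obj Y ⟶ (P.trW.Q.obj X)⟦n⟧) :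
    τ.quotientTrace hnm X (P.trW.Q.map f ≫ u ≫ (P.trW.Q.commShiftIso n).inv.app X) =
      τ.quotientTrace hnm Y (u ≫ (P.trW.Q.map f)⟦n⟧' ≫ (P.trW.Q.commShiftIso n).inv.app Y) := by
  rw [quotientTrace_map_comp, Category.assoc, Functor.commShiftIso_inv_naturality]

lemma quotientTrace_cyclic {X Y : C} (φ : P.trW.Q.obj X ⟶ P.trW.Q.obj Y)
    (u : P.trW.Q.obj Y ⟶ (P.trW.Q.obj X)⟦n⟧) :
    τ.quotientTrace hnm X (φ ≫ u ≫ (P.trW.Q.commShiftIso n).inv.app X) =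
      τ.quotientTrace hnm Y (u ≫ φ⟦n⟧' ≫ (P.trW.Q.commShiftIso n).inv.app Y) := by
  obtain ⟨X', N, s, i, δ, f, hN, hs, hf⟩ := exists_map_comp_eq_map φ
  have : IsIso (P.trW.Q.map s) := Localization.inverts P.trW.Q P.trW s ⟨_, _, _, hs, hN⟩
  obtain rfl : φ = inv (P.trW.Q.map s) ≫ P.trW.Q.map f := by simp [← hf]
  -- Cyclicity for the inverse of `s` is cyclicity for `s` applied to a conjugated morphism.
  have h₁ := τ.quotientTrace_map_comp_commShiftIso hnm s
    (inv (P.trW.Q.map s) ≫ P.trW.Q.map f ≫ u ≫ (inv (P.trW.Q.map s))⟦n⟧')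
  have h₂ := τ.quotientTrace_map_comp_commShiftIso hnm f (u ≫ (inv (P.trW.Q.map s))⟦n⟧')
  simp only [Category.assoc, IsIso.hom_inv_id_assoc, ← Functor.map_comp_assoc,
    IsIso.inv_hom_id, CategoryTheory.Functor.map_id, Category.id_comp] at h₁ h₂
  rw [Category.assoc, ← h₁, h₂]

end SerreTrace

lemma isCalabiYau_of_trace {D : Type*} [Category* D] [Preadditive D] [Linear k D]
    [HasShift D ℤ] [∀ n : ℤ, (shiftFunctor D n).Additive] {n : ℤ} (hfin : HomFinite k D)
    (tr : ∀ X : D, (X ⟶ X⟦n⟧) →ₗ[k] k)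
    (cyclic : ∀ ⦃X Y : D⦄ (f : X ⟶ Y) (u : Y ⟶ X⟦n⟧), tr X (f ≫ u) = tr Y (u ≫ f⟦n⟧'))
    (nondeg : ∀ ⦃X Y : D⦄ (u : Y ⟶ X⟦n⟧), (∀ f : X ⟶ Y, tr X (f ≫ u) = 0) → u = 0) :
    IsCalabiYau k D n := by
  let B (X Y : D) : (Y ⟶ X⟦n⟧) →ₗ[k] (X ⟶ Y) →ₗ[k] k :=
    LinearMap.mk₂ k (fun u f => tr X (f ≫ u)) (by simp) (by simp) (by simp) (by simp)
  have hB (X Y : D) : (B X Y).IsPerfPair := by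
    have := hfin Y (X⟦n⟧)
    apply LinearMap.IsPerfPair.of_injective
    · rw [injective_iff_map_eq_zero]
      exact fun u hu => nondeg u (fun f => LinearMap.congr_fun hu f)
    · rw [injective_iff_map_eq_zero]
      intro f hf
      -- Cyclicity turns the pairing with `f` into one with `f⟦n⟧'` on the other side, so
      -- nondegeneracy in one variable gives it in both.
      apply (shiftFunctor D n).map_injective
      rw [Functor.map_zero]
      refine nondeg _ (fun u => ?_)
      rw [← cyclic]
      exact LinearMap.congr_fun hf u
  refine ⟨fun X Y _ => (B X Y).toPerfPair.symm, fun X X' Y Y' _ _ f g φ => ?_⟩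
  dsimp only
  rw [LinearEquiv.symm_apply_eq]
  ext h
  obtain ⟨u, rfl⟩ := (B X Y).toPerfPair.surjective φ
  have := cyclic f (h ≫ g ≫ u)
  simp only [Category.assoc] at this
  rw [LinearEquiv.symm_apply_apply]
  simp [B, this]

theorem SerreTrace.isCalabiYau_verdierQuotient {n m : ℤ}
    (τ : SerreTrace k (shiftFunctor C m) P) (hnm : n + 1 = m)
    (hcov : ∀ X Y : C, ∃ (M : C) (p : M ⟶ X), P M ∧ ∀ f : X ⟶ Y, p ≫ f = 0 → f = 0)
    (henv : ∀ X Y : C, ∃ (N : C) (i : X ⟶ N), P N ∧ ∀ u : Y ⟶ X⟦m⟧, u ≫ i⟦m⟧' = 0 → u = 0)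
    (hfin : HomFinite k (VerdierQuotient P)) :
    IsCalabiYau k (VerdierQuotient P) n := by
  let pre := (Localization.Construction.objEquiv P.trW).symm
  have cyclic (X Y : C) (f : P.trW.Q.obj X ⟶ P.trW.Q.obj Y)
      (u : P.trW.Q.obj Y ⟶ (P.trW.Q.obj X)⟦n⟧) :
      τ.quotientTrace hnm X ((f ≫ u) ≫ (P.trW.Q.commShiftIso n).inv.app X) =
        τ.quotientTrace hnm Y ((u ≫ f⟦n⟧') ≫ (P.trW.Q.commShiftIso n).inv.app Y) := by
    simpa only [Category.assoc] using τ.quotientTrace_cyclic hnm f u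
  have nondeg (X Y : C) (u : P.trW.Q.obj Y ⟶ (P.trW.Q.obj X)⟦n⟧)
      (hu : ∀ f : P.trW.Q.obj X ⟶ P.trW.Q.obj Y,
        τ.quotientTrace hnm X ((f ≫ u) ≫ (P.trW.Q.commShiftIso n).inv.app X) = 0) : u = 0 := by
    rw [← cancel_mono ((P.trW.Q.commShiftIso n).inv.app X), zero_comp]
    exact τ.eq_zero_of_quotientTrace_eq_zero hnm (hcov X) (henv X) _
      (fun f => by rw [← hu f, Category.assoc])
  refine isCalabiYau_of_trace hfin
    (fun X => τ.quotientTrace hnm (pre X) ∘ₗ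
      Linear.rightComp k (P.trW.Q.obj (pre X)) ((P.trW.Q.commShiftIso n).inv.app (pre X)))
    (fun X Y f u => ?_) (fun X Y u hu => nondeg (pre X) (pre Y) u (fun f => ?_))
  · exact cyclic (pre X) (pre Y) f u
  · exact hu f

end Nondegenerate

/-! ### Boundedness and fullness on truncated objects -/

section Bounded

variable {C : Type u} [Category.{v} C] [Preadditive C] [HasZeroObject C] [HasShift C ℤ]
  [∀ n : ℤ, (shiftFunctor C n).Additive] [Pretriangulated C]

/-- The objects `Z` such that `Hom(Z, A⟦-l⟧) = 0` for `l` large. -/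
def eventuallyLeftOrthogonal (A : ObjectProperty C) : ObjectProperty C :=
  fun Z => ∃ l₀ : ℤ, ∀ l, l₀ ≤ l → ∀ ⦃a : C⦄, A.shift l a → ∀ f : Z ⟶ a, f = 0

/-- The objects `Y` such that `Hom(B⟦-l⟧, Y) = 0` for `-l` large. -/
def eventuallyRightOrthogonal (B : ObjectProperty C) : ObjectProperty C :=
  fun Y => ∃ l₀ : ℤ, ∀ l, l ≤ l₀ → ∀ ⦃b : C⦄, B.shift l b → ∀ f : b ⟶ Y, f = 0

omit [HasZeroObject C] [Pretriangulated C] in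
lemma hom_shift_eq_zero {Z a : C} (n : ℤ) (H : ∀ f : Z ⟶ a⟦-n⟧, f = 0) (f : Z⟦n⟧ ⟶ a) : f = 0 := by
  apply (shiftFunctor C (-n)).map_injective
  rw [Functor.map_zero, ← cancel_epi ((shiftFunctorCompIsoId C n (-n) (by simp)).inv.app Z),
    comp_zero]
  exact H _

omit [HasZeroObject C] [Pretriangulated C] in
lemma hom_to_shift_eq_zero {b Y : C} (n : ℤ) (H : ∀ f : b⟦-n⟧ ⟶ Y, f = 0) (f : b ⟶ Y⟦n⟧) :
    f = 0 := by
  apply (shiftFunctor C (-n)).map_injective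
  rw [Functor.map_zero, ← cancel_mono ((shiftFunctorCompIsoId C n (-n) (by simp)).hom.app Y),
    zero_comp]
  exact H _

omit [Preadditive C] [HasZeroObject C] [∀ n : ℤ, (shiftFunctor C n).Additive]
  [Pretriangulated C] in
lemma prop_shift_shift_iff (A : ObjectProperty C) [A.IsClosedUnderIsomorphisms] (X : C)
    {a b c : ℤ} (h : a + b = c) : A.shift b (X⟦a⟧) ↔ A.shift c X := by
  rw [← A.shift_shift a b c h]
  rfl

instance isThick_eventuallyLeftOrthogonal (A : ObjectProperty C) [A.IsClosedUnderIsomorphisms] :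
    IsThick (eventuallyLeftOrthogonal A) := by
  have retract : (eventuallyLeftOrthogonal A).IsStableUnderRetracts := ⟨by
    rintro X Y r ⟨l₀, h⟩
    refine ⟨l₀, fun l hl a ha f => ?_⟩
    rw [← Category.id_comp f, ← r.retract, Category.assoc, h l hl ha (r.r ≫ f), comp_zero]⟩
  exact
  { exists_zero := ⟨_, isZero_zero C, 0, fun _ _ _ _ f => (isZero_zero C).eq_of_src _ _⟩
    isStableUnderShiftBy := fun n => ⟨by
      rintro X ⟨l₀, h⟩
      refine ⟨l₀ - n, fun l hl a ha => hom_shift_eq_zero n (h (l + n) (by lia) ?_)⟩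
      exact (prop_shift_shift_iff A a (by lia)).2 ha⟩
    toIsTriangulatedClosed₂ := .mk' (by
      rintro T hT ⟨l₁, h₁⟩ ⟨l₃, h₃⟩
      refine ⟨max l₁ l₃, fun l hl a ha f => ?_⟩
      obtain ⟨g, rfl⟩ := Triangle.yoneda_exact₂ T hT f (h₁ l (by lia) ha _)
      rw [h₃ l (by lia) ha g, comp_zero])
    of_retract := retract.of_retract }

instance isThick_eventuallyRightOrthogonal (B : ObjectProperty C) [B.IsClosedUnderIsomorphisms] :
    IsThick (eventuallyRightOrthogonal B) := by
  have retract : (eventuallyRightOrthogonal B).IsStableUnderRetracts := ⟨by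
    rintro X Y r ⟨l₀, h⟩
    refine ⟨l₀, fun l hl a ha f => ?_⟩
    rw [← Category.comp_id f, ← r.retract, ← Category.assoc, h l hl ha (f ≫ r.i), zero_comp]⟩
  exact
  { exists_zero := ⟨_, isZero_zero C, 0, fun _ _ _ _ f => (isZero_zero C).eq_of_tgt _ _⟩
    isStableUnderShiftBy := fun n => ⟨by
      rintro X ⟨l₀, h⟩
      refine ⟨l₀ - n, fun l hl a ha => hom_to_shift_eq_zero n (h (l + n) (by lia) ?_)⟩
      exact (prop_shift_shift_iff B a (by lia)).2 ha⟩
    toIsTriangulatedClosed₂ := .mk' (by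
      rintro T hT ⟨l₁, h₁⟩ ⟨l₃, h₃⟩
      refine ⟨min l₁ l₃, fun l hl a ha f => ?_⟩
      obtain ⟨g, rfl⟩ := Triangle.coyoneda_exact₂ T hT f (h₃ l (by lia) ha _)
      rw [h₁ l (by lia) ha g, zero_comp])
    of_retract := retract.of_retract }

lemma eventuallyLeftOrthogonal_of_thickGenerates {S : ObjectProperty C} (hS : ThickGenerates S)
    (Z : C) : eventuallyLeftOrthogonal (shiftsIn S (Set.Ici 0)).rightOrthogonal Z := by
  refine hS _ inferInstance (fun X hX => ⟨0, fun l hl a ha f => ?_⟩) Z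
  apply (shiftFunctor C l).map_injective
  rw [Functor.map_zero]
  exact ha _ ⟨X, l, hX, hl, ⟨Iso.refl _⟩⟩

lemma eventuallyRightOrthogonal_of_thickGenerates {S : ObjectProperty C} (hS : ThickGenerates S)
    (Y : C) : eventuallyRightOrthogonal (shiftsIn S (Set.Iio 0)).leftOrthogonal Y := by
  refine hS _ inferInstance (fun X hX => ⟨-1, fun l hl a ha f => ?_⟩) Y
  apply (shiftFunctor C l).map_injective
  rw [Functor.map_zero]
  exact ha _ ⟨X, l, hX, by simp only [Set.mem_Iio]; lia, ⟨Iso.refl _⟩⟩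

lemma IsCoTStructure.exists_triangle_shift {A B : ObjectProperty C} (h : IsCoTStructure A B)
    (X : C) (l : ℤ) : ∃ (a b : C) (f : a ⟶ X) (g : X ⟶ b) (δ : b ⟶ a⟦(1 : ℤ)⟧),
      Triangle.mk f g δ ∈ distTriang C ∧ A.shift l a ∧ B.shift l b := by
  have := h.retracts_left
  have := h.retracts_right
  have key : ObjectProperty.extensionProduct (A.shift l) (B.shift l) (X⟦l⟧⟦-l⟧) := by
    obtain ⟨a, b, f, g, δ, hT, ha, hb⟩ := h.exists_triangle (X⟦l⟧)
    refine ⟨_, _, _, _, _, Triangle.shift_distinguished _ hT (-l), ?_, ?_⟩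
    · exact A.prop_of_iso ((shiftFunctorCompIsoId C (-l) l (by simp)).symm.app a) ha
    · exact B.prop_of_iso ((shiftFunctorCompIsoId C (-l) l (by simp)).symm.app b) hb
  exact (ObjectProperty.extensionProduct (A.shift l) (B.shift l)).prop_of_iso
    ((shiftFunctorCompIsoId C l (-l) (by simp)).app X) key

omit [HasZeroObject C] [Pretriangulated C] in
lemma rightOrthogonal_shiftsIn_antitone (S : ObjectProperty C) {l l' : ℤ} (hl : l' ≤ l) :
    (shiftsIn S (Set.Ici 0)).rightOrthogonal.shift l ≤
      (shiftsIn S (Set.Ici 0)).rightOrthogonal.shift l' := by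
  rintro a ha W f ⟨X, n, hX, hn, ⟨e⟩⟩
  apply (shiftFunctor C (l - l')).map_injective
  rw [Functor.map_zero, ← cancel_mono ((shiftFunctorAdd' C l' (l - l') l (by lia)).inv.app a),
    zero_comp]
  exact ha _ ⟨X, n + (l - l'), hX, by simp only [Set.mem_Ici] at hn ⊢; lia,
    ⟨(shiftFunctor C (l - l')).mapIso e ≪≫ (shiftFunctorAdd' C n (l - l') _ rfl).symm.app X⟩⟩

/-- The quotient functor is full on `Hom(a, Y)` if every morphism from `a` to an object of `P`
factors through an object `c` of `P` such that `Hom(c⟦-1⟧, Y) = 0`. -/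
lemma map_surjective_of_factors [IsTriangulated C] {P : ObjectProperty C} [P.IsTriangulated]
    {a Y : C} (H : ∀ ⦃N : C⦄ (i : a ⟶ N), P N → ∃ (a' c : C) (t : a' ⟶ a) (g : a ⟶ c)
      (δ : c ⟶ a'⟦(1 : ℤ)⟧), Triangle.mk t g δ ∈ distTriang C ∧ P c ∧ t ≫ i = 0 ∧
        ∀ f : c⟦(-1 : ℤ)⟧ ⟶ Y, f = 0)
    (φ : P.trW.Q.obj a ⟶ P.trW.Q.obj Y) : ∃ f : a ⟶ Y, P.trW.Q.map f = φ := by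
  obtain ⟨a₁, N, s, i, δ, f, hN, hs, hf⟩ := exists_map_comp_eq_map φ
  obtain ⟨a', c, t, g, ε, ht, hc, hti, hcY⟩ := H i hN
  -- The denominator `s` is refined to `t`, along which the numerator extends to `a` because its
  -- obstruction lies in `Hom(c⟦-1⟧, Y) = 0`.
  obtain ⟨r, hr⟩ : ∃ r : a' ⟶ a₁, t = r ≫ s := Triangle.coyoneda_exact₂ _ hs t hti
  obtain ⟨f', hf'⟩ : ∃ f' : a ⟶ Y, r ≫ f = t ≫ f' :=
    Triangle.yoneda_exact₂ _ (inv_rot_of_distTriang _ ht) (r ≫ f) (hcY _)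
  have : IsIso (P.trW.Q.map t) := Localization.inverts P.trW.Q P.trW t ⟨_, _, _, ht, hc⟩
  refine ⟨f', ?_⟩
  rw [← cancel_epi (P.trW.Q.map t), ← Functor.map_comp]
  rw [← hf', Functor.map_comp, ← hf, hr, Functor.map_comp, Category.assoc]

end Bounded

/-! ### Approximations and Hom-finiteness for the triple -/

section Triple

variable {k : Type w} [Field k] {C : Type u} [Category.{v} C] [Preadditive C] [Linear k C]
  [HasZeroObject C] [HasShift C ℤ] [∀ n : ℤ, (shiftFunctor C n).Additive]
  [Pretriangulated C]
  {d : ℕ} {P : ObjectProperty C} [IsThick P] {S : ObjectProperty C}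

namespace IsNegativeCalabiYauTriple

variable (h : IsNegativeCalabiYauTriple k d P S)
include h

/-- In a sufficiently shifted truncation triangle the third term has no maps to `Y`, so nothing
nonzero is killed by `p`. -/
lemma exists_cover (X Y : C) :
    ∃ (M : C) (p : M ⟶ X), P M ∧ ∀ f : X ⟶ Y, p ≫ f = 0 → f = 0 := by
  obtain ⟨l, hl⟩ := eventuallyRightOrthogonal_of_thickGenerates h.smc.thick Y
  obtain ⟨a, b, p, g, δ, hT, ha, hb⟩ := h.coT_left.exists_triangle_shift X l
  refine ⟨a, p, (P.prop_shift_iff_of_isStableUnderShift a l).1 (h.left_le _ ha), fun f hf => ?_⟩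
  obtain ⟨q, rfl⟩ : ∃ q : b ⟶ Y, f = g ≫ q := Triangle.yoneda_exact₂ _ hT f hf
  rw [hl l le_rfl hb q, comp_zero]

lemma exists_triangle_right (X : C) (l : ℤ) :
    ∃ (a b : C) (f : a ⟶ X) (g : X ⟶ b) (δ : b ⟶ a⟦(1 : ℤ)⟧), Triangle.mk f g δ ∈ distTriang C ∧
      (shiftsIn S (Set.Ici 0)).rightOrthogonal.shift l a ∧ P b := by
  obtain ⟨a, b, f, g, δ, hT, ha, hb⟩ := h.coT_right.exists_triangle_shift X l
  exact ⟨a, b, f, g, δ, hT, ha,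
    (P.prop_shift_iff_of_isStableUnderShift b l).1 (h.right_le _ hb)⟩

lemma exists_envelope (X Y : C) :
    ∃ (N : C) (i : X ⟶ N), P N ∧ ∀ f : Y ⟶ X, f ≫ i = 0 → f = 0 := by
  obtain ⟨l, hl⟩ := eventuallyLeftOrthogonal_of_thickGenerates h.smc.thick Y
  obtain ⟨a, b, g, i, δ, hT, ha, hb⟩ := h.exists_triangle_right X l
  refine ⟨b, i, hb, fun f hf => ?_⟩
  obtain ⟨q, rfl⟩ : ∃ q : Y ⟶ a, f = q ≫ g := Triangle.coyoneda_exact₂ _ hT f hf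
  rw [hl l le_rfl ha q, zero_comp]

lemma exists_envelope_shift (n : ℤ) (X Y : C) :
    ∃ (N : C) (i : X ⟶ N), P N ∧ ∀ u : Y ⟶ X⟦n⟧, u ≫ i⟦n⟧' = 0 → u = 0 := by
  obtain ⟨N, i, hN, hi⟩ := h.exists_envelope X (Y⟦-n⟧)
  refine ⟨N, i, hN, fun u hu => ?_⟩
  let e := (shiftFunctorCompIsoId C (-n) n (by simp)).hom.app Y
  obtain ⟨v, hv⟩ : ∃ v : Y⟦-n⟧ ⟶ X, v⟦n⟧' = e ≫ u := (shiftFunctor C n).map_surjective _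
  rw [← cancel_epi e, ← hv, hi v, Functor.map_zero, comp_zero]
  apply (shiftFunctor C n).map_injective
  rw [Functor.map_comp, hv, Category.assoc, hu, comp_zero, Functor.map_zero]

lemma homFinite_verdierQuotient [∀ n : ℤ, (shiftFunctor C n).Linear k] [IsTriangulated C] :
    HomFinite k (VerdierQuotient P) := by
  obtain ⟨τ⟩ := h.serre.nonempty_serreTrace
  let A := (shiftsIn S (Set.Ici 0)).rightOrthogonal
  suffices key : ∀ X Y : C, Module.Finite k (P.trW.Q.obj X ⟶ P.trW.Q.obj Y) from
    fun X Y => key ((Localization.Construction.objEquiv P.trW).symm X)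
      ((Localization.Construction.objEquiv P.trW).symm Y)
  intro X Y
  obtain ⟨l₀, hl₀⟩ := eventuallyLeftOrthogonal_of_thickGenerates h.smc.thick Y
  -- Below, Serre duality turns `Hom(c⟦-1⟧, Y)` into the dual of `Hom(Y, c⟦-1⟧⟦-d⟧)`; a `c` at level
  -- `j` puts the target at level `j + 1 + d`.
  obtain ⟨j, hj⟩ : ∃ j : ℤ, j + 1 + d = l₀ := ⟨l₀ - 1 - d, by lia⟩
  obtain ⟨a, b, f, g, δ, hT, ha, hb⟩ := h.exists_triangle_right X j
  have surj : ∀ φ : P.trW.Q.obj a ⟶ P.trW.Q.obj Y, ∃ f : a ⟶ Y, P.trW.Q.map f = φ := by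
    apply map_surjective_of_factors
    intro N i hN
    obtain ⟨l₁, hl₁⟩ := eventuallyLeftOrthogonal_of_thickGenerates h.smc.thick (N⟦(d : ℤ)⟧)
    -- Level `l₁` kills `Hom(N⟦d⟧, a')`, hence dually `Hom(a', N)`. Level `j + 1` puts `a'⟦1⟧`, and
    -- so the extension `c` of `a'⟦1⟧` by `a`, at level `j`.
    obtain ⟨a', c, t, g, δ, hT, ha', hc⟩ := h.exists_triangle_right a (max l₁ (j + 1))
    refine ⟨a', c, t, g, δ, hT, hc, ?_, ?_⟩
    · have hN' : P (N⟦(d : ℤ)⟧) := P.le_shift _ _ hN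
      let e : N ≅ N⟦(d : ℤ)⟧⟦-(d : ℤ)⟧ :=
        (shiftFunctorCompIsoId C (d : ℤ) (-d) (by simp)).symm.app N
      rw [← cancel_mono e.hom, zero_comp]
      refine τ.eq_zero hN' _ (fun v => ?_)
      rw [hl₁ _ (le_max_left _ _) ha' v, zero_comp, map_zero]
    · have hcA : A.shift j c := by
        refine A.ext_of_isTriangulatedClosed₂ _ (Triangle.shift_distinguished _
          (rot_of_distTriang _ hT) j) ha ?_
        refine (prop_shift_shift_iff A a' rfl).2
          (rightOrthogonal_shiftsIn_antitone S (?_ : 1 + j ≤ max l₁ (j + 1)) _ ha')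
        exact le_trans (by lia) (le_max_right _ _)
      refine τ.hom_eq_zero (P.le_shift (-1) _ hc) (fun u => ?_)
      refine hl₀ l₀ le_rfl ?_ u
      exact (prop_shift_shift_iff A _ (c := j + 1) (by lia)).2
        ((prop_shift_shift_iff A c (by lia)).2 hcA)
  have := h.homFinite a Y
  have : Module.Finite k (P.trW.Q.obj a ⟶ P.trW.Q.obj Y) :=
    Module.Finite.of_surjective (P.trW.Q.mapLinearMap k) surj
  have : IsIso (P.trW.Q.map f) := Localization.inverts P.trW.Q P.trW f ⟨_, _, _, hT, hb⟩
  exact Module.Finite.equiv (Linear.homCongr k (asIso (P.trW.Q.map f)) (Iso.refl (P.trW.Q.obj Y)))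

end IsNegativeCalabiYauTriple

end Triple

end NegCY

theorem theorem4p4 {k : Type w} [Field k] {T : Type u} [Category.{v} T] [Preadditive T]
    [Linear k T] [HasZeroObject T] [HasShift T ℤ] [∀ n : ℤ, (shiftFunctor T n).Additive]
    [∀ n : ℤ, (shiftFunctor T n).Linear k] [Pretriangulated T] [IsTriangulated T]
    (d : ℕ) (Tp : ObjectProperty T) [NegCY.IsThick Tp] (S : ObjectProperty T)
    (h : NegCY.IsNegativeCalabiYauTriple k d Tp S) :
    NegCY.HomFinite k (NegCY.VerdierQuotient Tp) ∧
      NegCY.IsCalabiYau k (NegCY.VerdierQuotient Tp) (-(d : ℤ) - 1) := by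
  obtain ⟨τ⟩ := h.serre.nonempty_serreTrace
  have hfin := h.homFinite_verdierQuotient
  exact ⟨hfin, τ.isCalabiYau_verdierQuotient (by lia) h.exists_cover
    (h.exists_envelope_shift _) hfin⟩
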